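/- Let $d\colon\mathbb{R}\to\mathbb{R}$ be an additive function and let $\xi\colon I\to\mathbb{R}$ be one of the following functions on the open interval $I$ (on which it is differentiable): (a) $\xi(x)=\ln(x)$, $I=\,]0,+\infty[$; (b) $\xi(x)=\arccos(x)$, $I=\,]-1,1[$; (c) $\xi(x)=\arcsin(x)$, $I=\,]-1,1[$; (d) $\xi(x)=\mathrm{arcosh}(x)$, $I=\,]1,+\infty[$; (e) $\xi(x)=\mathrm{arsinh}(x)$, $I=\mathbb{R}$. Suppose that the mapping $\varphi\colon I\to\mathbb{R}$, $$\varphi(x)=d\left(\xi(x)\right)-\xi'(x)\,d(x)\qquad (x\in I),$$ is regular, that is, that at least one of the following holds: (i) $\varphi$ is bounded on a Lebesgue measurable subset of $I$ of positive measure; (ii) $\varphi$ is continuous at some point of $I$; (iii) there is a Lebesgue measurable subset of $I$ of positive measure such that the restriction of $\varphi$ to it is Lebesgue measurable. Then there is a derivation $\chi\colon\mathbb{R}\to\mathbb{R}$ (an additive function with $\chi(xy)=\chi(x)y+x\chi(y)$ for all $x,y\in\mathbb{R}$) such that $$d(x)=\chi(x)+d(1)\cdot x\qquad (x\in\mathbb{R}).$$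 -/

import Mathlib

/-- `f`, viewed as a real function with domain `I`, is (locally) regular: it is bounded on a Lebesgue
measurable set of positive measure, or continuous at some point of its domain, or its restriction to
some Lebesgue measurable set of positive measure is Lebesgue measurable.
(A set is Lebesgue measurable iff it is a `NullMeasurableSet` for the volume.) -/
def IsRegularOn (f : ℝ → ℝ) (I : Set ℝ) : Prop :=
  (∃ S : Set ℝ, S ⊆ I ∧ MeasureTheory.NullMeasurableSet S MeasureTheory.volume ∧
      0 < MeasureTheory.volume S ∧ ∃ C : ℝ, ∀ x ∈ S, |f x| ≤ C) ∨
  (∃ x ∈ I, ContinuousWithinAt f I x) ∨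
  (∃ S : Set ℝ, S ⊆ I ∧ MeasureTheory.NullMeasurableSet S MeasureTheory.volume ∧
      0 < MeasureTheory.volume S ∧
      ∀ B : Set ℝ, MeasurableSet B →
        MeasureTheory.NullMeasurableSet (S ∩ f ⁻¹' B) MeasureTheory.volume)

open MeasureTheory Set Filter Topology

/-! Let `f` be the inverse of `ξ`, with `g = f'`. Both satisfy `f (t + s) + f (t - s) = 2 * f t * c
s` with `c` = `cos` or `cosh`. Applying `d` writes the Leibniz defect of `d` at `(f t, c s)` through
values of `d (f t) - g t * d t`, which is `-g t * φ (f t)`, plus terms bounded in `t`. For small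
fixed `s` the defect, additive in its first variable, is thus bounded on a set of positive measure,
hence linear. Varying `s` makes it `-d 1 * x * y` everywhere, so `d - d 1 * id` is a derivation. -/

theorem AddMonoidHom.eq_mul_map_one_of_bounded_on_pos_measure (h : ℝ →+ ℝ) {S : Set ℝ}
    (hS : MeasurableSet S) (hpos : 0 < volume S) {C : ℝ} (hC : ∀ x ∈ S, |h x| ≤ C) (x : ℝ) :
    h x = x * h 1 := by
  have hcont : Continuous h := by
    -- Steinhaus: `S - S` is a neighbourhood of zero, and `h` is bounded on it.
    refine h.continuous_of_isBounded_nhds_zero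
      (Measure.sub_mem_nhds_zero_of_addHaar_pos volume S hS hpos) ?_
    refine isBounded_iff_forall_norm_le.2 ⟨C + C, ?_⟩
    rintro _ ⟨_, ⟨a, ha, b, hb, rfl⟩, rfl⟩
    rw [map_sub]
    exact (norm_sub_le _ _).trans (add_le_add (hC a ha) (hC b hb))
  simpa using map_real_smul h hcont x 1

theorem exists_isCompact_subset_pos_measure {S : Set ℝ} (hS : NullMeasurableSet S volume)
    (hpos : 0 < volume S) : ∃ K ⊆ S, IsCompact K ∧ 0 < volume K := by
  obtain ⟨T, hTS, hT, hae⟩ := hS.exists_measurable_subset_ae_eq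
  obtain ⟨K, hKT, hK, hKpos⟩ := hT.exists_lt_isCompact (measure_congr hae ▸ hpos)
  exact ⟨K, hKT.trans hTS, hK, hKpos⟩

theorem IsRegularOn.exists_isCompact_bounded {φ : ℝ → ℝ} {I : Set ℝ} (hI : IsOpen I)
    (h : IsRegularOn φ I) :
    ∃ K ⊆ I, IsCompact K ∧ 0 < volume K ∧ ∃ C : ℝ, ∀ x ∈ K, |φ x| ≤ C := by
  suffices H : ∃ S ⊆ I, NullMeasurableSet S volume ∧ 0 < volume S ∧ ∃ C : ℝ, ∀ x ∈ S, |φ x| ≤ C by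
    obtain ⟨S, hSI, hS, hpos, C, hC⟩ := H
    obtain ⟨K, hKS, hK, hKpos⟩ := exists_isCompact_subset_pos_measure hS hpos
    exact ⟨K, hKS.trans hSI, hK, hKpos, C, fun x hx => hC x (hKS hx)⟩
  rcases h with ⟨S, hSI, hS, hpos, C, hC⟩ | ⟨x, hxI, hx⟩ | ⟨S, hSI, hS, hpos, hmeas⟩
  · exact ⟨S, hSI, hS, hpos, C, hC⟩
  · have hc : ContinuousAt φ x := hx.continuousAt (hI.mem_nhds hxI)
    have hev : ∀ᶠ y in 𝓝 x, y ∈ I ∧ |φ y| < |φ x| + 1 :=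
      Filter.Eventually.and (hI.eventually_mem hxI) (hc.abs.eventually_lt_const (lt_add_one _))
    obtain ⟨U, hU, hUo, hxU⟩ := eventually_nhds_iff.1 hev
    exact ⟨U, fun y hy => (hU y hy).1, hUo.measurableSet.nullMeasurableSet,
      hUo.measure_pos _ ⟨x, hxU⟩, |φ x| + 1, fun y hy => (hU y hy).2.le⟩
  · have hcover : (⋃ n : ℕ, S ∩ φ ⁻¹' Icc (-(n : ℝ)) n) = S := by
      ext x
      simp only [mem_iUnion, mem_inter_iff, mem_preimage, mem_Icc, ← abs_le, exists_and_left,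
        and_iff_left_iff_imp]
      exact fun _ => exists_nat_ge _
    obtain ⟨n, hn⟩ := exists_measure_pos_of_not_measure_iUnion_null (μ := volume)
      (s := fun n : ℕ => S ∩ φ ⁻¹' Icc (-(n : ℝ)) n) (by rw [hcover]; exact hpos.ne')
    exact ⟨_, inter_subset_left.trans hSI, hmeas _ measurableSet_Icc, hn, n,
      fun x hx => abs_le.2 hx.2⟩

/-- Small translates of `K` stay in an open `U ⊇ K` of measure below `3/2` that of `K`, so each
misses less than half of the measure of `K`. -/
theorem IsCompact.exists_pos_measure_inter_translates {K : Set ℝ} (hK : IsCompact K)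
    (hpos : 0 < volume K) :
    ∃ ε > 0, ∀ s : ℝ, |s| < ε →
      0 < volume (K ∩ ((fun t => t + s) ⁻¹' K ∩ (fun t => t - s) ⁻¹' K)) := by
  have hfin : volume K ≠ ⊤ := hK.measure_ne_top
  obtain ⟨U, hKU, hUo, hU⟩ := K.exists_isOpen_lt_add hfin
    (ENNReal.half_pos hpos.ne').ne'
  obtain ⟨ε, hε, hεU⟩ := hK.exists_thickening_subset_open hUo hKU
  have key : ∀ s : ℝ, |s| < ε → volume (U \ (fun t => t + s) ⁻¹' K) < volume K / 2 := by
    intro s hs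
    have hsub : (fun t => t + s) ⁻¹' K ⊆ U := fun t ht =>
      hεU (Metric.mem_thickening_iff.2 ⟨t + s, ht, by simpa [Real.dist_eq] using hs⟩)
    have hvol : volume ((fun t => t + s) ⁻¹' K) = volume K := measure_preimage_add_right _ _ _
    refine measure_sdiff_lt_of_lt_add
      (hK.measurableSet.preimage (measurable_add_const s)).nullMeasurableSet hsub ?_ ?_
    · rwa [hvol]
    · rwa [hvol]
  refine ⟨ε, hε, fun s hs => pos_iff_ne_zero.2 fun h0 => ?_⟩
  have h1 := key s hs
  have h2 := key (-s) (by rwa [abs_neg])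
  simp only [← sub_eq_add_neg] at h2
  set A := (fun t : ℝ => t + s) ⁻¹' K
  set B := (fun t : ℝ => t - s) ⁻¹' K
  have hcov : K ⊆ (K ∩ (A ∩ B)) ∪ ((U \ A) ∪ (U \ B)) := by
    intro t ht
    have := hKU ht
    by_cases hA : t ∈ A <;> by_cases hB : t ∈ B <;> simp [*]
  have : volume K < volume K := calc
    volume K ≤ volume (K ∩ (A ∩ B)) + (volume (U \ A) + volume (U \ B)) :=
      (measure_mono hcov).trans ((measure_union_le _ _).trans
        (add_le_add_right (measure_union_le _ _) _))
    _ = volume (U \ A) + volume (U \ B) := by rw [h0, zero_add]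
    _ < volume K / 2 + volume K / 2 := ENNReal.add_lt_add h1 h2
    _ = volume K := ENNReal.add_halves _
  exact lt_irrefl _ this

/-- The deviation of an additive function from the Leibniz rule, as an additive function of the
first variable. -/
noncomputable def leibnizDefect (d : ℝ →+ ℝ) (y : ℝ) : ℝ →+ ℝ :=
  AddMonoidHom.mk' (fun x => d (x * y) - x * d y - y * d x) fun a b => by
    simp only [add_mul, map_add]; ring

theorem leibnizDefect_apply (d : ℝ →+ ℝ) (x y : ℝ) :
    leibnizDefect d y x = d (x * y) - x * d y - y * d x := rfl

theorem leibnizDefect_comm (d : ℝ →+ ℝ) (x y : ℝ) :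
    leibnizDefect d y x = leibnizDefect d x y := by
  simp only [leibnizDefect_apply, mul_comm x y]; ring

theorem exists_derivation_of_leibnizDefect_eq (d : ℝ →+ ℝ)
    (h : ∀ x y, leibnizDefect d y x = -(d 1) * (x * y)) :
    ∃ χ : Derivation ℤ ℝ ℝ, ∀ x : ℝ, d x = χ x + d 1 * x := by
  let l : ℝ →+ ℝ := d - AddMonoidHom.mulLeft (d 1)
  have hl : ∀ x, l x = d x - d 1 * x := fun x => rfl
  refine ⟨Derivation.mk' l.toIntLinearMap fun a b => ?_, fun x => ?_⟩
  · have := h a b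
    rw [leibnizDefect_apply] at this
    simp only [AddMonoidHom.coe_toIntLinearMap, hl, smul_eq_mul]
    linarith
  · change d x = l x + d 1 * x
    rw [hl]
    ring

/-- By symmetry the defect is additive in `y` too; an additive function vanishing on an interval is
zero. -/
theorem leibnizDefect_eq_of_forall_mem_Icc (d : ℝ →+ ℝ) {a b : ℝ} (hab : a < b)
    (h : ∀ y ∈ Icc a b, ∀ x, leibnizDefect d y x = -(d 1) * (x * y)) (x y : ℝ) :
    leibnizDefect d y x = -(d 1) * (x * y) := by
  let k : ℝ →+ ℝ := leibnizDefect d x + AddMonoidHom.mulLeft (d 1 * x)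
  have hk : ∀ y, k y = leibnizDefect d y x + d 1 * x * y := fun y => by
    rw [leibnizDefect_comm]; rfl
  have hk0 : ∀ y ∈ Icc a b, k y = 0 := fun y hy => by rw [hk, h y hy]; ring
  have hlin := k.eq_mul_map_one_of_bounded_on_pos_measure (measurableSet_Icc (a := a) (b := b))
    (by simpa using hab) (C := 0) fun y hy => by simp [hk0 y hy]
  have h1 : k 1 = 0 := by
    have ha := hlin a
    have hb := hlin b
    rw [hk0 a ⟨le_rfl, hab.le⟩] at ha
    rw [hk0 b ⟨hab.le, le_rfl⟩] at hb
    have : (b - a) * k 1 = 0 := by linarith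
    exact (mul_eq_zero.1 this).resolve_left (sub_pos.2 hab).ne'
  have := hlin y
  rw [hk, h1] at this
  linarith

theorem two_mul_leibnizDefect_of_addition_formula (d : ℝ →+ ℝ) {f g c : ℝ → ℝ}
    (hf : ∀ t s, f (t + s) + f (t - s) = 2 * f t * c s)
    (hg : ∀ t s, g (t + s) + g (t - s) = 2 * g t * c s) (t s : ℝ) :
    2 * leibnizDefect d (c s) (f t) =
      (d (f (t + s)) - g (t + s) * d (t + s)) + (d (f (t - s)) - g (t - s) * d (t - s))
        - 2 * c s * (d (f t) - g t * d t) + (g (t + s) - g (t - s)) * d s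
        - 2 * f t * d (c s) := by
  have h1 : d (f (t + s)) + d (f (t - s)) = 2 * d (f t * c s) := by
    rw [← map_add, hf, mul_assoc, two_mul, map_add, two_mul]
  have h2 := hg t s
  rw [leibnizDefect_apply, map_add, map_sub]
  linear_combination (-1 : ℝ) * h1 + d t * h2

theorem exists_derivation_of_addition_formula (d : ℝ →+ ℝ) {f g c ξ : ℝ → ℝ} {I : Set ℝ}
    (hI : IsOpen I) (hfd : Differentiable ℝ f) (hgc : Continuous g) (hcc : Continuous c)
    (hc1 : ∀ ε > 0, ∃ s, |s| < ε ∧ c s ≠ c 0)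
    (hf : ∀ t s, f (t + s) + f (t - s) = 2 * f t * c s)
    (hg : ∀ t s, g (t + s) + g (t - s) = 2 * g t * c s)
    (hfξ : ∀ x ∈ I, f (ξ x) = x) (hg0 : ∀ x ∈ I, g (ξ x) ≠ 0)
    (hξ : ∀ x ∈ I, HasDerivAt ξ (g (ξ x))⁻¹ x)
    (hreg : IsRegularOn (fun x => d (ξ x) - deriv ξ x * d x) I) :
    ∃ χ : Derivation ℤ ℝ ℝ, ∀ x : ℝ, d x = χ x + d 1 * x := by
  obtain ⟨S, hSI, hS, hSpos, C, hC⟩ := hreg.exists_isCompact_bounded hI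
  have hT : IsCompact (ξ '' S) := hS.image_of_continuousOn fun x hx =>
    (hξ x (hSI hx)).continuousAt.continuousWithinAt
  -- Differentiable maps preserve null sets, and `f` maps `ξ '' S` back onto `S`.
  have hTpos : 0 < volume (ξ '' S) := pos_iff_ne_zero.2 fun h0 => by
    have := addHaar_image_eq_zero_of_differentiableOn_of_addHaar_eq_zero volume
      hfd.differentiableOn h0
    rw [image_image, image_congr fun x hx => hfξ x (hSI hx), image_id'] at this
    exact hSpos.ne' this
  obtain ⟨F, hF⟩ := hT.exists_bound_of_continuousOn hfd.continuous.continuousOn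
  obtain ⟨G, hG⟩ := hT.exists_bound_of_continuousOn hgc.continuousOn
  simp only [Real.norm_eq_abs] at hF hG
  have he : ∀ t ∈ ξ '' S, |d (f t) - g t * d t| ≤ G * C := by
    rintro _ ⟨x, hx, rfl⟩
    have hgx := hg0 x (hSI hx)
    have hb := hC x hx
    simp only [(hξ x (hSI hx)).deriv] at hb
    have heq : d (f (ξ x)) - g (ξ x) * d (ξ x)
        = -(g (ξ x) * (d (ξ x) - (g (ξ x))⁻¹ * d x)) := by
      rw [hfξ x (hSI hx)]; field_simp; ring
    rw [heq, abs_neg, abs_mul]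
    have hGx := hG _ (mem_image_of_mem ξ hx)
    exact mul_le_mul hGx hb (abs_nonneg _) ((abs_nonneg _).trans hGx)
  obtain ⟨ε, hε, hεT⟩ := hT.exists_pos_measure_inter_translates hTpos
  have hlin : ∀ s, |s| < ε → ∀ x, leibnizDefect d (c s) x = -(d 1) * (x * c s) := by
    intro s hs x
    set R := ξ '' S ∩ ((fun t => t + s) ⁻¹' (ξ '' S) ∩ (fun t => t - s) ⁻¹' (ξ '' S))
    have hRc : IsCompact R := hT.inter_right
      ((hT.isClosed.preimage (continuous_add_const s)).inter
        (hT.isClosed.preimage (continuous_sub_right s)))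
    have hRpos : 0 < volume (f '' R) := pos_iff_ne_zero.2 fun h0 => by
      have hsub : f '' R ⊆ I := by
        rintro _ ⟨_, ⟨⟨y, hy, rfl⟩, -⟩, rfl⟩
        rw [hfξ y (hSI hy)]
        exact hSI hy
      have := addHaar_image_eq_zero_of_differentiableOn_of_addHaar_eq_zero volume
        (f := ξ) (fun y hy => (hξ y (hsub hy)).differentiableAt.differentiableWithinAt) h0
      have hid : ∀ t ∈ R, ξ (f t) = t := by
        rintro _ ⟨⟨y, hy, rfl⟩, -⟩
        rw [hfξ y (hSI hy)]
      rw [image_image, image_congr hid, image_id'] at this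
      exact (hεT s hs).ne' this
    rw [AddMonoidHom.eq_mul_map_one_of_bounded_on_pos_measure (leibnizDefect d (c s))
      (hRc.image hfd.continuous).measurableSet hRpos
      (C := (G * C + G * C + 2 * |c s| * (G * C) + (G + G) * |d s| + 2 * F * |d (c s)|) / 2) ?_ x]
    -- The slope is the defect at `x = 1`, namely `-d 1 * c s`.
    · simp only [leibnizDefect_apply, one_mul]; ring
    rintro _ ⟨t, ⟨ht, hts, hts'⟩, rfl⟩
    simp only [mem_preimage] at hts hts'
    rw [le_div_iff₀ two_pos, mul_comm]
    have h2 : (2 : ℝ) * |leibnizDefect d (c s) (f t)| = |2 * leibnizDefect d (c s) (f t)| := by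
      rw [abs_mul, abs_two]
    rw [h2, two_mul_leibnizDefect_of_addition_formula d hf hg]
    refine (abs_sub _ _).trans (add_le_add ((abs_add_le _ _).trans (add_le_add
      ((abs_sub _ _).trans (add_le_add ((abs_add_le _ _).trans (add_le_add (he _ hts) (he _ hts')))
        ?_)) ?_)) ?_)
    · rw [abs_mul, abs_mul, abs_two]
      exact mul_le_mul_of_nonneg_left (he t ht) (by positivity)
    · rw [abs_mul]
      exact mul_le_mul_of_nonneg_right
        ((abs_sub _ _).trans (add_le_add (hG _ hts) (hG _ hts'))) (abs_nonneg _)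
    · rw [abs_mul, abs_mul, abs_two]
      exact mul_le_mul_of_nonneg_right
        (mul_le_mul_of_nonneg_left (hF t ht) two_pos.le) (abs_nonneg _)
  refine exists_derivation_of_leibnizDefect_eq d ?_
  obtain ⟨s, hs, hcs⟩ := hc1 ε hε
  refine leibnizDefect_eq_of_forall_mem_Icc d (min_lt_max.2 hcs.symm) fun y hy => ?_
  -- Every `y` between `c 0` and `c s` is some `c r` with `|r| ≤ |s|`.
  obtain ⟨r, hr, rfl⟩ := intermediate_value_uIcc hcc.continuousOn hy
  refine hlin r (lt_of_le_of_lt ?_ hs)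
  simpa using abs_sub_left_of_mem_uIcc hr

theorem exists_abs_lt_cos_ne {ε : ℝ} (hε : 0 < ε) :
    ∃ s, |s| < ε ∧ Real.cos s ≠ Real.cos 0 := by
  have hm : 0 < min (ε / 2) 1 := lt_min (half_pos hε) one_pos
  refine ⟨min (ε / 2) 1, ?_, fun h => ?_⟩
  · rw [abs_of_pos hm]
    exact (min_le_left _ _).trans_lt (half_lt_self hε)
  · have h1 := min_le_right (ε / 2) 1
    have hpi := Real.pi_gt_three
    rw [Real.cos_zero, Real.cos_eq_one_iff_of_lt_of_lt (by linarith) (by linarith)] at h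
    exact hm.ne' h

theorem exists_abs_lt_cosh_ne {ε : ℝ} (hε : 0 < ε) :
    ∃ s, |s| < ε ∧ Real.cosh s ≠ Real.cosh 0 := by
  refine ⟨ε / 2, ?_, ?_⟩
  · rw [abs_of_pos (half_pos hε)]
    exact half_lt_self hε
  · rw [Real.cosh_zero]
    exact (Real.one_lt_cosh.2 (half_pos hε).ne').ne'

theorem mainTheorem11 (d : ℝ →+ ℝ) (ξ : ℝ → ℝ) (I : Set ℝ)
    (hξ : (ξ = Real.log ∧ I = Set.Ioi 0) ∨
      (ξ = Real.arccos ∧ I = Set.Ioo (-1) 1) ∨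
      (ξ = Real.arcsin ∧ I = Set.Ioo (-1) 1) ∨
      (ξ = Real.arcosh ∧ I = Set.Ioi 1) ∨
      (ξ = Real.arsinh ∧ I = Set.univ))
    (hreg : IsRegularOn (fun x => d (ξ x) - deriv ξ x * d x) I) :
    ∃ χ : Derivation ℤ ℝ ℝ, ∀ x : ℝ, d x = χ x + d 1 * x := by
  have hsin : ∀ t s, Real.sin (t + s) + Real.sin (t - s) = 2 * Real.sin t * Real.cos s :=
    fun t s => by rw [Real.sin_add, Real.sin_sub]; ring
  have hcos : ∀ t s, Real.cos (t + s) + Real.cos (t - s) = 2 * Real.cos t * Real.cos s :=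
    fun t s => by rw [Real.cos_add, Real.cos_sub]; ring
  have hsinh : ∀ t s, Real.sinh (t + s) + Real.sinh (t - s) = 2 * Real.sinh t * Real.cosh s :=
    fun t s => by rw [Real.sinh_add, Real.sinh_sub]; ring
  have hcosh : ∀ t s, Real.cosh (t + s) + Real.cosh (t - s) = 2 * Real.cosh t * Real.cosh s :=
    fun t s => by rw [Real.cosh_add, Real.cosh_sub]; ring
  have hexp : ∀ t s, Real.exp (t + s) + Real.exp (t - s) = 2 * Real.exp t * Real.cosh s :=
    fun t s => by rw [Real.cosh_eq, sub_eq_add_neg, Real.exp_add, Real.exp_add]; ring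
  have hroot : ∀ x ∈ Ioo (-1 : ℝ) 1, √(1 - x ^ 2) ≠ 0 := fun x hx =>
    (Real.sqrt_pos.2 (by nlinarith [hx.1, hx.2])).ne'
  rcases hξ with ⟨rfl, rfl⟩ | ⟨rfl, rfl⟩ | ⟨rfl, rfl⟩ | ⟨rfl, rfl⟩ | ⟨rfl, rfl⟩
  · refine exists_derivation_of_addition_formula d isOpen_Ioi Real.differentiable_exp
      Real.continuous_exp Real.continuous_cosh (fun _ => exists_abs_lt_cosh_ne) hexp hexp
      (fun x hx => Real.exp_log hx) (fun x _ => (Real.exp_pos _).ne') (fun x hx => ?_) hreg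
    rw [Real.exp_log hx]
    exact Real.hasDerivAt_log (ne_of_gt hx)
  · have hneg : ∀ x, -Real.sin (Real.arccos x) = -√(1 - x ^ 2) := fun x => by
      rw [Real.sin_arccos]
    refine exists_derivation_of_addition_formula (g := fun t => -Real.sin t) d isOpen_Ioo
      Real.differentiable_cos Real.continuous_sin.neg Real.continuous_cos
      (fun _ => exists_abs_lt_cos_ne) hcos (fun t s => by linarith [hsin t s])
      (fun x hx => Real.cos_arccos hx.1.le hx.2.le) (fun x hx => ?_) (fun x hx => ?_) hreg
    · rw [hneg]
      exact neg_ne_zero.2 (hroot x hx)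
    · rw [hneg, inv_neg, ← one_div]
      exact Real.hasDerivAt_arccos hx.1.ne' hx.2.ne
  · refine exists_derivation_of_addition_formula d isOpen_Ioo
      Real.differentiable_sin Real.continuous_cos Real.continuous_cos
      (fun _ => exists_abs_lt_cos_ne) hsin hcos
      (fun x hx => Real.sin_arcsin hx.1.le hx.2.le) (fun x hx => ?_) (fun x hx => ?_) hreg
    · rw [Real.cos_arcsin]
      exact hroot x hx
    · rw [Real.cos_arcsin, ← one_div]
      exact Real.hasDerivAt_arcsin hx.1.ne' hx.2.ne
  · refine exists_derivation_of_addition_formula d isOpen_Ioi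
      Real.differentiable_cosh Real.continuous_sinh Real.continuous_cosh
      (fun _ => exists_abs_lt_cosh_ne) hcosh hsinh
      (fun x hx => Real.cosh_arcosh (le_of_lt hx))
      (fun x hx => (Real.sinh_pos_iff.2 (Real.arcosh_pos hx)).ne') (fun x hx => ?_) hreg
    rw [Real.sinh_arcosh (le_of_lt hx)]
    exact Real.hasDerivAt_arcosh hx
  · refine exists_derivation_of_addition_formula d isOpen_univ
      Real.differentiable_sinh Real.continuous_cosh Real.continuous_cosh
      (fun _ => exists_abs_lt_cosh_ne) hsinh hcosh
      (fun x _ => Real.sinh_arsinh x) (fun x _ => (Real.cosh_pos _).ne') (fun x _ => ?_) hreg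
    rw [Real.cosh_arsinh]
    exact Real.hasDerivAt_arsinh x
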